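/- Let $N\ge 2$ and let $(K,V_i)_{i=0}^{N-1}$ be a row co-isometry: $K$ is a complex Hilbert space and $V_0,\dots,V_{N-1}$ are bounded operators on $K$ with $\sum_{i=0}^{N-1}V_iV_i^*=1_K$. Let $(H,S_i)_{i=0}^{N-1}$ be its Cuntz dilation: $H$ is a Hilbert space containing $K$ as a closed subspace, the bounded operators $S_i$ on $H$ satisfy the Cuntz relations $S_i^*S_j=\delta_{ij}1_H$ and $\sum_{i=0}^{N-1}S_iS_i^*=1_H$, one has $S_i^*K\subseteq K$ and $S_i^*|_K=V_i^*$ for all $i$ (so $V_i=pS_i|_K$, where $p$ is the orthogonal projection of $H$ onto $K$), and $K$ is cyclic for the $*$-algebra generated by the $S_i$, i.e. the vectors $Ak$ with $A$ in this algebra and $k\in K$ have dense linear span in $H$. Let $\Omega$ be the set of finite words over $\{0,\dots,N-1\}$, including the empty word, and for $\omega=\omega_1\cdots\omega_n\in\Omega$ put $V_\omega=V_{\omega_1}\cdots V_{\omega_n}$ and $S_\omega=S_{\omega_1}\cdots S_{\omega_n}$, with the empty word giving the identity. Let $\beta=i_0\cdots i_{p-1}\in\Omega$ be a non-empty word that is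 irreducible, i.e. not of the form $\omega\omega\cdots\omega$ ($k$ times) for a word $\omega$ and an integer $k\ge2$, and let $\Omega_\beta$ be the set of all words in $\Omega$ that do not end in $\beta$ (it contains the empty word). Let $v_0\in K$ be a unit vector with $V_{i_{p-1}}^*\cdots V_{i_0}^*v_0=v_0$, i.e. $V_\beta^*v_0=v_0$. Then the following are equivalent: 1. The family $(V_\omega v_0)_{\omega\in\Omega_\beta}$ is a Parseval frame for $K$, i.e. $\|v\|^2=\sum_{\omega\in\Omega_\beta}|\langle v,V_\omega v_0\rangle|^2$ for all $v\in K$. 2. The family $(S_\omega v_0)_{\omega\in\Omega_\beta}$ is an orthonormal basis of $H$. 3. The closed linear span of $\{S_\omega v_0:\omega\in\Omega\}$ is $H$. 4. The representation $(H,S_i)_{i=0}^{N-1}$ is irreducible, i.e. $H\ne0$ and the only closed subspaces of $H$ invariant under all $S_i$ and $S_i^*$ are $\{0\}$ and $H$. 5. The commutant $\{S_0,\dots,S_{N-1}\}'$ in $\mathcal B(H)$ equals $\mathbb C\cdot 1_H$. 6. $\mathcal B(K)^\sigma:=\{A\in\mathcal B(K):\sum_{i=0}^{N-1}V_iAV_i^*=A\}$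 equals $\mathbb C\cdot 1_K$. -/

import Mathlib

open ContinuousLinearMap

noncomputable section

/-- Words `ω = ω₁ … ωₙ` are lists of digits; the operator `T_ω = T_{ω₁} ⋯ T_{ωₙ}`
(composition), the identity for the empty word. -/
def wordOp {N : ℕ} {E : Type*} [NormedAddCommGroup E] [InnerProductSpace ℂ E]
    (T : Fin N → E →L[ℂ] E) (ω : List (Fin N)) : E →L[ℂ] E :=
  (ω.map T).prod

/-- A non-empty word which is not of the form `ω ω ⋯ ω` (`k ≥ 2` times). -/
def IsIrreducibleWord {α : Type*} (β : List α) : Prop :=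
  β ≠ [] ∧ ¬ ∃ (ω : List α) (k : ℕ), 2 ≤ k ∧ β = (List.replicate k ω).flatten

/-- The set `Ω_β` of the words that do not end in `β`. -/
def wordsNotEndingIn {α : Type*} (β : List α) : Set (List α) :=
  {ω | ¬ β <:+ ω}

/-- Row co-isometry: `∑ V_i V_i^* = 1`. -/
def IsRowCoisometry {N : ℕ} {K : Type*} [NormedAddCommGroup K] [InnerProductSpace ℂ K]
    [CompleteSpace K] (V : Fin N → K →L[ℂ] K) : Prop :=
  ∑ i, V i * adjoint (V i) = 1

/-- Cuntz relations, i.e. a representation of the Cuntz algebra `𝒪_N`: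
`S_i^* S_j = δ_{ij}` and `∑ S_i S_i^* = 1`. -/
structure IsCuntzFamily {N : ℕ} {H : Type*} [NormedAddCommGroup H] [InnerProductSpace ℂ H]
    [CompleteSpace H] (S : Fin N → H →L[ℂ] H) : Prop where
  adjoint_mul : ∀ i j, adjoint (S i) * S j = if i = j then 1 else 0
  sum_mul_adjoint : ∑ i, S i * adjoint (S i) = 1

/-- `(H, S)` is the Cuntz dilation of `(K, V)`, where `K` is embedded in `H` by `ι`:
`S` satisfies the Cuntz relations, each `S_i^*` leaves (the image of) `K` invariant and restricts
to `V_i^*` there (equivalently `V_i^* p = S_i^* p = p S_i^* p`, which gives `V_i = p S_i|_K`), and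
`K` is cyclic for the *-algebra generated by the `S_i`. -/
structure IsCuntzDilation {N : ℕ} {K H : Type*}
    [NormedAddCommGroup K] [InnerProductSpace ℂ K] [CompleteSpace K]
    [NormedAddCommGroup H] [InnerProductSpace ℂ H] [CompleteSpace H]
    (V : Fin N → K →L[ℂ] K) (S : Fin N → H →L[ℂ] H) (ι : K →ₗᵢ[ℂ] H) : Prop where
  cuntz : IsCuntzFamily S
  adjoint_apply : ∀ i k, adjoint (S i) (ι k) = ι (adjoint (V i) k)
  cyclic : (Submodule.span ℂ
    {x : H | ∃ A ∈ StarAlgebra.adjoin ℂ (Set.range S), ∃ k : K, x = A (ι k)}).topologicalClosure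
      = ⊤

/-- Parseval frame: `‖v‖² = ∑ |⟨v, e_j⟩|²` for all `v`. -/
def IsParsevalFrame {J E : Type*} [NormedAddCommGroup E] [InnerProductSpace ℂ E]
    (e : J → E) : Prop :=
  ∀ v : E, HasSum (fun j => ‖inner ℂ v (e j)‖ ^ 2) (‖v‖ ^ 2)

/-- The family is an orthonormal basis, in the Hilbert space sense. -/
def IsONB {J E : Type*} [NormedAddCommGroup E] [InnerProductSpace ℂ E] (e : J → E) : Prop :=
  ∃ b : HilbertBasis J ℂ E, ⇑b = e

/-- Irreducibility of the representation given by `S`: the space is non-zero and the only closed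
subspaces invariant under all `S_i` and `S_i^*` are `0` and the whole space. -/
def IsIrreducibleRep {N : ℕ} {H : Type*} [NormedAddCommGroup H] [InnerProductSpace ℂ H]
    [CompleteSpace H] (S : Fin N → H →L[ℂ] H) : Prop :=
  Nontrivial H ∧ ∀ W : Submodule ℂ H, IsClosed (W : Set H) →
    (∀ i, ∀ x ∈ W, S i x ∈ W) → (∀ i, ∀ x ∈ W, adjoint (S i) x ∈ W) → W = ⊥ ∨ W = ⊤

/-- The scalar operators `ℂ · 1`. -/
def scalarOps (E : Type*) [NormedAddCommGroup E] [InnerProductSpace ℂ E] : Set (E →L[ℂ] E) :=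
  Set.range fun c : ℂ => c • (1 : E →L[ℂ] E)

/-- The fixed points of `σ(A) = ∑ V_i A V_i^*`. -/
def sigmaFixedPoints {N : ℕ} {K : Type*} [NormedAddCommGroup K] [InnerProductSpace ℂ K]
    [CompleteSpace K] (V : Fin N → K →L[ℂ] K) : Set (K →L[ℂ] K) :=
  {A | ∑ i, V i * A * adjoint (V i) = A}

end

/-! Since `S_β` is an isometry and `S_β^*` extends `V_β^*`, the vector `v₀` is fixed by `S_β`
itself, so `S_ω v₀` is unchanged when powers of `β` are appended to `ω`. Irreducibility of `β` lets
two distinct words of `Ω_β` be made prefix-incomparable in this way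
(`IsIrreducibleWord.exists_incomparable`), so the vectors `S_ω v₀`, `ω ∈ Ω_β`, are always
orthonormal. Their closed span is also the span over all words, and it is reducing; only its
totality is in question. Compressing to `K` turns an orthonormal basis into a Parseval frame;
conversely, the Parseval identity and Bessel's inequality put `K` inside the span, which is then
everything by cyclicity of `K`. The analytic step is from totality to `B(K)^σ = ℂ`
(`sigmaFixedPoints_eq_of_cyclic`). For a fixed point `B` with `⟨B v₀, v₀⟩ = 0`, the iterates of `X ↦
∑ S_i X S_i^*` on `ι B ι^*` keep the compression `B`, yet tend weakly to `0`; hence `B = 0`.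
Compressing the commutant to `K` is injective with values in `B(K)^σ`, which gives the trivial
commutant, then irreducibility, then totality again. -/

open ContinuousLinearMap

/-! ### Combinatorics of irreducible words -/

section Words

variable {α : Type*}

theorem length_flatten_replicate (k : ℕ) (w : List α) :
    (List.replicate k w).flatten.length = k * w.length := by
  simp

theorem flatten_replicate_succ (k : ℕ) (w : List α) :
    (List.replicate (k + 1) w).flatten = w ++ (List.replicate k w).flatten := by
  simp [List.replicate_succ]

theorem flatten_replicate_add (a b : ℕ) (w : List α) :
    (List.replicate (a + b) w).flatten =
      (List.replicate a w).flatten ++ (List.replicate b w).flatten := by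
  rw [List.replicate_add, List.flatten_append]

/-- Two commuting words are powers of a common word. -/
theorem exists_common_root_of_append_comm (n : ℕ) :
    ∀ x y : List α, x.length + y.length ≤ n → x ++ y = y ++ x →
      ∃ (w : List α) (a b : ℕ),
        x = (List.replicate a w).flatten ∧ y = (List.replicate b w).flatten := by
  induction n with
  | zero =>
    intro x y h _
    have hx : x = [] := List.length_eq_zero_iff.mp (by omega)
    have hy : y = [] := List.length_eq_zero_iff.mp (by omega)
    exact ⟨[], 0, 0, by simp [hx], by simp [hy]⟩
  | succ n ih =>
    have key : ∀ x y : List α, x.length + y.length ≤ n + 1 → x.length ≤ y.length →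
        x ++ y = y ++ x → ∃ (w : List α) (a b : ℕ),
        x = (List.replicate a w).flatten ∧ y = (List.replicate b w).flatten := by
      intro x y h hle hc
      rcases eq_or_ne x [] with rfl | hx
      · exact ⟨y, 0, 1, by simp, by simp⟩
      have hpre : x <+: y :=
        List.prefix_of_prefix_length_le (hc ▸ List.prefix_append x y) (List.prefix_append y x) hle
      obtain ⟨z, rfl⟩ := hpre
      have hxl : 0 < x.length := List.length_pos_iff.mpr hx
      have hz : x ++ z = z ++ x := by
        rw [List.append_assoc] at hc
        exact List.append_cancel_left hc
      obtain ⟨w, a, b, ha, hb⟩ := ih x z (by simp at h; omega) hz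
      refine ⟨w, a, a + b, ha, ?_⟩
      rw [flatten_replicate_add, ← ha, ← hb]
    intro x y h hc
    rcases le_total x.length y.length with hle | hle
    · exact key x y h hle hc
    · obtain ⟨w, a, b, ha, hb⟩ := key y x (by omega) hle hc.symm
      exact ⟨w, b, a, hb, ha⟩

theorem IsIrreducibleWord.eq_nil_of_append_comm {x y : List α}
    (h : IsIrreducibleWord (x ++ y)) (hc : x ++ y = y ++ x) (hy : y ≠ []) : x = [] := by
  by_contra hx
  obtain ⟨w, a, b, ha, hb⟩ := exists_common_root_of_append_comm _ x y le_rfl hc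
  refine h.2 ⟨w, a + b, ?_, by rw [flatten_replicate_add, ← ha, ← hb]⟩
  have : a ≠ 0 := by rintro rfl; simp at ha; exact hx ha
  have : b ≠ 0 := by rintro rfl; simp at hb; exact hy hb
  omega

/-- An irreducible word occurs in a power of itself only at the obvious places. -/
theorem IsIrreducibleWord.eq_power_of_append_prefix {β : List α} (hβ : IsIrreducibleWord β) :
    ∀ (k : ℕ) (ε : List α), ε ++ β <+: (List.replicate k β).flatten →
      ∃ j, ε = (List.replicate j β).flatten := by
  intro k
  induction k with
  | zero =>
    intro ε h
    have : β = [] := by simp at h; exact h.2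
    exact absurd this hβ.1
  | succ k ih =>
    intro ε h
    rw [flatten_replicate_succ] at h
    rcases le_or_gt β.length ε.length with hle | hlt
    · have hpre : β <+: ε := List.prefix_of_prefix_length_le (List.prefix_append _ _)
        ((List.prefix_append _ _).trans h) hle
      obtain ⟨ε', rfl⟩ := hpre
      rw [List.append_assoc, List.prefix_append_right_inj] at h
      obtain ⟨j, rfl⟩ := ih ε' h
      exact ⟨j + 1, (flatten_replicate_succ j β).symm⟩
    · have hpre : ε <+: β := List.prefix_of_prefix_length_le ((List.prefix_append _ _).trans h)
        (List.prefix_append _ _) hlt.le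
      obtain ⟨ζ, rfl⟩ := hpre
      have hζ : ζ ≠ [] := by rintro rfl; simp at hlt
      refine ⟨0, ?_⟩
      simp only [List.replicate_zero, List.flatten_nil]
      cases k with
      | zero =>
        have := h.length_le
        simp at this
        simpa using this
      | succ k =>
        -- With `β = εζ`, cancelling `ε` leaves `εζ` and `ζε` as prefixes of one word, so `ε` and
        -- `ζ` commute.
        rw [flatten_replicate_succ, List.append_assoc, List.prefix_append_right_inj] at h
        have h2 : ζ ++ ε <+: ζ ++ (ε ++ ζ ++ (List.replicate k (ε ++ ζ)).flatten) := by
          simp [List.append_assoc]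
        have h3 : ε ++ ζ <+: ζ ++ ε :=
          List.prefix_of_prefix_length_le h h2 (by simp [add_comm])
        exact hβ.eq_nil_of_append_comm (h3.eq_of_length (by simp [add_comm])) hζ

/-- Two distinct words not ending in an irreducible word `β` become incomparable for the prefix
order after appending powers of `β`. -/
theorem IsIrreducibleWord.exists_incomparable {β : List α} (hβ : IsIrreducibleWord β)
    {γ δ : List α} (hγ : γ ∈ wordsNotEndingIn β) (hδ : δ ∈ wordsNotEndingIn β) (hne : γ ≠ δ) :
    ∃ k m : ℕ,
      ¬ γ ++ (List.replicate k β).flatten <+: δ ++ (List.replicate m β).flatten ∧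
      ¬ δ ++ (List.replicate m β).flatten <+: γ ++ (List.replicate k β).flatten := by
  -- The exponent `δ.length + 1` makes the word built on the shorter `γ` at least as long as `δβ`. A
  -- prefix relation in the wrong direction is then an equality, so only one direction needs an
  -- argument.
  have key : ∀ γ δ : List α, δ ∈ wordsNotEndingIn β → γ ≠ δ → γ.length ≤ δ.length →
      ¬ γ ++ (List.replicate (δ.length + 1) β).flatten <+: δ ++ (List.replicate 1 β).flatten ∧
      ¬ δ ++ (List.replicate 1 β).flatten <+: γ ++ (List.replicate (δ.length + 1) β).flatten := by
    intro γ δ hδ hne hle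
    have hβl : 1 ≤ β.length := List.length_pos_iff.mpr hβ.1
    have h2 : ¬ δ ++ (List.replicate 1 β).flatten <+:
        γ ++ (List.replicate (δ.length + 1) β).flatten := by
      intro h
      have hpre : γ <+: δ := List.prefix_of_prefix_length_le (List.prefix_append _ _)
        ((List.prefix_append _ _).trans h) hle
      obtain ⟨ε, rfl⟩ := hpre
      rw [List.append_assoc, List.prefix_append_right_inj] at h
      obtain ⟨j, rfl⟩ := hβ.eq_power_of_append_prefix _ ε (by simpa using h)
      cases j with
      | zero => simp at hne
      | succ j =>
        apply hδ
        rw [flatten_replicate_add, ← List.append_assoc]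
        exact ⟨γ ++ (List.replicate j β).flatten, by simp⟩
    refine ⟨fun h => h2 ?_, h2⟩
    have hl : (δ ++ (List.replicate 1 β).flatten).length ≤
        (γ ++ (List.replicate (δ.length + 1) β).flatten).length := by
      simp only [List.length_append, length_flatten_replicate]
      nlinarith
    rw [h.eq_of_length_le hl]
  rcases le_total γ.length δ.length with hle | hle
  · exact ⟨_, _, key γ δ hδ hne hle⟩
  · exact ⟨_, _, (key δ γ hγ hne.symm hle).symm⟩

theorem exists_mem_wordsNotEndingIn {β : List α} (hβ : β ≠ []) (ω : List α) :
    ∃ ω' ∈ wordsNotEndingIn β, ∃ k : ℕ, ω = ω' ++ (List.replicate k β).flatten := by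
  induction h : ω.length using Nat.strong_induction_on generalizing ω with
  | _ n ih =>
    by_cases hω : β <:+ ω
    · obtain ⟨τ, rfl⟩ := hω
      have hβl : 0 < β.length := List.length_pos_iff.mpr hβ
      obtain ⟨ω', hω', k, rfl⟩ := ih τ.length (by simp at h; omega) τ rfl
      refine ⟨ω', hω', k + 1, ?_⟩
      rw [flatten_replicate_add, ← List.append_assoc]
      simp
    · exact ⟨ω, hω, 0, by simp⟩

end Words

/-! ### Operators indexed by words -/

section WordOp

variable {N : ℕ} {E : Type*} [NormedAddCommGroup E] [InnerProductSpace ℂ E]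

@[simp] theorem wordOp_nil (T : Fin N → E →L[ℂ] E) : wordOp T [] = 1 := by
  simp [wordOp]

theorem wordOp_cons (T : Fin N → E →L[ℂ] E) (i : Fin N) (ω : List (Fin N)) :
    wordOp T (i :: ω) = T i * wordOp T ω := by
  simp [wordOp]

theorem wordOp_append (T : Fin N → E →L[ℂ] E) (ω τ : List (Fin N)) :
    wordOp T (ω ++ τ) = wordOp T ω * wordOp T τ := by
  simp [wordOp]

theorem wordOp_power_apply {T : Fin N → E →L[ℂ] E} {β : List (Fin N)} {x : E}
    (hx : wordOp T β x = x) (k : ℕ) : wordOp T (List.replicate k β).flatten x = x := by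
  induction k with
  | zero => simp
  | succ k ih => simp [flatten_replicate_succ, wordOp_append, ih, hx]

theorem wordOp_append_power_apply {T : Fin N → E →L[ℂ] E} {β : List (Fin N)} {x : E}
    (hx : wordOp T β x = x) (ω : List (Fin N)) (k : ℕ) :
    wordOp T (ω ++ (List.replicate k β).flatten) x = wordOp T ω x := by
  simp [wordOp_append, wordOp_power_apply hx]

theorem range_wordOp_eq {T : Fin N → E →L[ℂ] E} {β : List (Fin N)} (hβ : β ≠ []) {x : E}
    (hx : wordOp T β x = x) :
    Set.range (fun ω : wordsNotEndingIn β => wordOp T ω.1 x) =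
      Set.range (fun ω : List (Fin N) => wordOp T ω x) := by
  apply Set.Subset.antisymm
  · rintro _ ⟨ω, rfl⟩
    exact ⟨ω.1, rfl⟩
  · rintro _ ⟨ω, rfl⟩
    obtain ⟨ω', hω', k, rfl⟩ := exists_mem_wordsNotEndingIn hβ ω
    exact ⟨⟨ω', hω'⟩, (wordOp_append_power_apply hx ω' k).symm⟩

end WordOp

/-! ### Total sets and weak convergence -/

section Density

variable {E : Type*} [NormedAddCommGroup E] [InnerProductSpace ℂ E]

theorem mem_topologicalClosure_span_of_forall {s : Set E} {W : Submodule ℂ E}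
    (hW : IsClosed (W : Set E)) (T : E →L[ℂ] E) (h : ∀ x ∈ s, T x ∈ W) :
    ∀ x ∈ (Submodule.span ℂ s).topologicalClosure, T x ∈ W := by
  have hle : (Submodule.span ℂ s).topologicalClosure ≤ W.comap (T : E →ₗ[ℂ] E) :=
    Submodule.topologicalClosure_minimal _ (Submodule.span_le.mpr h) (hW.preimage T.continuous)
  exact fun x hx => hle hx

theorem clm_eq_zero_of_forall {F : Type*} [NormedAddCommGroup F] [NormedSpace ℂ F] {s : Set E}
    (hs : (Submodule.span ℂ s).topologicalClosure = ⊤) (T : E →L[ℂ] F)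
    (h : ∀ x ∈ s, T x = 0) : T = 0 := by
  have hle : (Submodule.span ℂ s).topologicalClosure ≤ LinearMap.ker (T : E →ₗ[ℂ] F) :=
    Submodule.topologicalClosure_minimal _ (Submodule.span_le.mpr h)
      (isClosed_singleton.preimage T.continuous)
  ext x
  exact hle (hs ▸ Submodule.mem_top)

/-- A bounded sequence of functionals that tends to zero pointwise on a total set tends to zero
pointwise everywhere. -/
theorem tendsto_zero_of_total {s : Set E} (hs : (Submodule.span ℂ s).topologicalClosure = ⊤)
    (f : ℕ → E →L[ℂ] ℂ) (C : ℝ) (hC : ∀ n, ‖f n‖ ≤ C)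
    (h : ∀ x ∈ s, Filter.Tendsto (fun n => f n x) Filter.atTop (nhds 0)) (x : E) :
    Filter.Tendsto (fun n => f n x) Filter.atTop (nhds 0) := by
  have hspan : ∀ y ∈ Submodule.span ℂ s,
      Filter.Tendsto (fun n => f n y) Filter.atTop (nhds 0) := by
    intro y hy
    induction hy using Submodule.span_induction with
    | mem y hy => exact h y hy
    | zero => simp
    | add y z _ _ hy hz => simpa using hy.add hz
    | smul c y _ hy => simpa using hy.const_mul c
  have hC0 : 0 ≤ C := (norm_nonneg _).trans (hC 0)
  rw [Metric.tendsto_atTop]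
  intro ε hε
  have hx : x ∈ closure (Submodule.span ℂ s : Set E) := by
    rw [← Submodule.topologicalClosure_coe, hs]; trivial
  -- `C + 1` rather than `C`, because `C` may be zero.
  obtain ⟨y, hy, hxy⟩ := Metric.mem_closure_iff.mp hx (ε / (2 * (C + 1))) (by positivity)
  obtain ⟨n₀, hn₀⟩ := Metric.tendsto_atTop.mp (hspan y hy) (ε / 2) (by positivity)
  refine ⟨n₀, fun n hn => ?_⟩
  have h1 := hn₀ n hn
  rw [dist_zero_right] at h1 ⊢
  rw [dist_eq_norm] at hxy
  have h2 : ‖f n (x - y)‖ ≤ ε / 2 := by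
    calc ‖f n (x - y)‖ ≤ C * ‖x - y‖ := (f n).le_of_opNorm_le (hC n) _
      _ ≤ (C + 1) * (ε / (2 * (C + 1))) := by gcongr; linarith
      _ = ε / 2 := by field_simp
  calc ‖f n x‖ = ‖f n (x - y) + f n y‖ := by rw [← map_add, sub_add_cancel]
    _ ≤ ‖f n (x - y)‖ + ‖f n y‖ := norm_add_le _ _
    _ < ε := by linarith

/-- A bounded sequence of operators whose matrix coefficients tend to zero on a total set tends
weakly to zero. -/
theorem tendsto_inner_zero_of_total {s : Set E}
    (hs : (Submodule.span ℂ s).topologicalClosure = ⊤) (T : ℕ → E →L[ℂ] E) (C : ℝ)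
    (hC : ∀ n, ‖T n‖ ≤ C)
    (h : ∀ x ∈ s, ∀ y ∈ s,
      Filter.Tendsto (fun n => inner ℂ (T n x) y) Filter.atTop (nhds 0)) (x y : E) :
    Filter.Tendsto (fun n => inner ℂ (T n x) y) Filter.atTop (nhds 0) := by
  have step : ∀ x ∈ s, ∀ y,
      Filter.Tendsto (fun n => inner ℂ (T n x) y) Filter.atTop (nhds 0) := by
    intro x hx y
    refine tendsto_zero_of_total hs (fun n => innerSL ℂ (T n x)) (C * ‖x‖) (fun n => ?_)
      (fun y hy => by simpa using h x hx y hy) y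
    rw [innerSL_apply_norm]
    exact (T n).le_of_opNorm_le (hC n) x
  -- The inner product is conjugate-linear in its first slot; swapping the slots preserves the
  -- modulus and yields a linear functional of `x`.
  have flip : ∀ x, Filter.Tendsto (fun n => inner ℂ (T n x) y) Filter.atTop (nhds 0) ↔
      Filter.Tendsto (fun n => (innerSL ℂ y ∘L T n) x) Filter.atTop (nhds 0) := by
    intro x
    rw [tendsto_zero_iff_norm_tendsto_zero,
      tendsto_zero_iff_norm_tendsto_zero (f := fun n => (innerSL ℂ y ∘L T n) x)]
    simp only [comp_apply, innerSL_apply_apply, norm_inner_symm y]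
  rw [flip]
  refine tendsto_zero_of_total hs _ (‖y‖ * C) (fun n => ?_)
    (fun x hx => (flip x).mp (step x hx y)) x
  refine (opNorm_comp_le _ _).trans ?_
  rw [innerSL_apply_norm]
  gcongr
  exact hC n

theorem apply_mem_wordSpan {N : ℕ} {S : Fin N → E →L[ℂ] E} (x : E) (i : Fin N) :
    ∀ y ∈ (Submodule.span ℂ
      (Set.range fun ω : List (Fin N) => wordOp S ω x)).topologicalClosure,
      S i y ∈ (Submodule.span ℂ
        (Set.range fun ω : List (Fin N) => wordOp S ω x)).topologicalClosure := by
  refine mem_topologicalClosure_span_of_forall (Submodule.isClosed_topologicalClosure _) _ ?_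
  rintro _ ⟨ω, rfl⟩
  exact Submodule.le_topologicalClosure _
    (Submodule.subset_span ⟨i :: ω, by simp [wordOp_cons]⟩)

end Density

/-! ### Cuntz families and the endomorphism `X ↦ ∑ S_i X S_i^*` -/

section Cuntz

variable {N : ℕ} {H : Type*} [NormedAddCommGroup H] [InnerProductSpace ℂ H] [CompleteSpace H]
  {S : Fin N → H →L[ℂ] H}

namespace IsCuntzFamily

theorem adjoint_apply_apply (hS : IsCuntzFamily S) (i j : Fin N) (x : H) :
    adjoint (S i) (S j x) = if i = j then x else 0 := by
  change (adjoint (S i) * S j) x = _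
  rw [hS.adjoint_mul]
  split_ifs <;> simp

theorem sum_apply_adjoint_apply (hS : IsCuntzFamily S) (x : H) :
    ∑ i, S i (adjoint (S i) x) = x := by
  have := congrArg (fun T : H →L[ℂ] H => T x) hS.sum_mul_adjoint
  simpa [sum_apply] using this

theorem inner_apply_apply (hS : IsCuntzFamily S) (i j : Fin N) (x y : H) :
    inner ℂ (S i x) (S j y) = if i = j then inner ℂ x y else 0 := by
  rw [← adjoint_inner_right, hS.adjoint_apply_apply]
  split_ifs <;> simp

theorem inner_wordOp_wordOp (hS : IsCuntzFamily S) (ω : List (Fin N)) (x y : H) :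
    inner ℂ (wordOp S ω x) (wordOp S ω y) = inner ℂ x y := by
  induction ω with
  | nil => simp
  | cons i ω ih => simp [wordOp_cons, hS.inner_apply_apply, ih]

theorem norm_wordOp (hS : IsCuntzFamily S) (ω : List (Fin N)) (x : H) :
    ‖wordOp S ω x‖ = ‖x‖ := by
  rw [@norm_eq_sqrt_re_inner ℂ, hS.inner_wordOp_wordOp, ← @norm_eq_sqrt_re_inner ℂ]

theorem norm_sum_sq (hS : IsCuntzFamily S) (y : Fin N → H) :
    ‖∑ i, S i (y i)‖ ^ 2 = ∑ i, ‖y i‖ ^ 2 := by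
  have h : inner ℂ (∑ i, S i (y i)) (∑ i, S i (y i)) = ∑ i, inner ℂ (y i) (y i) := by
    rw [sum_inner]
    simp only [inner_sum, hS.inner_apply_apply, Finset.sum_ite_eq, Finset.mem_univ, if_true]
  simp only [inner_self_eq_norm_sq_to_K] at h
  exact_mod_cast h

theorem sum_norm_adjoint_sq (hS : IsCuntzFamily S) (x : H) :
    ∑ i, ‖adjoint (S i) x‖ ^ 2 = ‖x‖ ^ 2 := by
  rw [← hS.norm_sum_sq, hS.sum_apply_adjoint_apply]

/-- Vectors fixed by `S_β^*` are fixed by the isometry `S_β`. -/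
theorem wordOp_apply_of_adjoint_apply (hS : IsCuntzFamily S) {ω : List (Fin N)} {x : H}
    (hx : adjoint (wordOp S ω) x = x) : wordOp S ω x = x := by
  have h : ‖wordOp S ω x - x‖ ^ 2 = 0 := by
    rw [@norm_sub_sq ℂ, hS.norm_wordOp, ← adjoint_inner_right, hx, inner_self_eq_norm_sq]
    ring
  exact sub_eq_zero.mp (norm_eq_zero.mp (pow_eq_zero_iff two_ne_zero |>.mp h))

/-- Expanding `x = ∑ S_j S_j^* x` shows that commuting with the `S_i` alone already forces commuting
with their adjoints. -/
theorem mul_adjoint_eq_of_comm (hS : IsCuntzFamily S) {A : H →L[ℂ] H}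
    (hA : ∀ i x, A (S i x) = S i (A x)) (i : Fin N) (x : H) :
    adjoint (S i) (A x) = A (adjoint (S i) x) := by
  conv_lhs => rw [← hS.sum_apply_adjoint_apply x]
  simp [hA, hS.adjoint_apply_apply]

end IsCuntzFamily

/-- The endomorphism `X ↦ ∑ S_i X S_i^*` of `B(H)`. -/
noncomputable def cuntzEndo (S : Fin N → H →L[ℂ] H) (X : H →L[ℂ] H) : H →L[ℂ] H :=
  ∑ i, S i * X * adjoint (S i)

theorem cuntzEndo_apply (S : Fin N → H →L[ℂ] H) (X : H →L[ℂ] H) (x : H) :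
    cuntzEndo S X x = ∑ i, S i (X (adjoint (S i) x)) := by
  simp [cuntzEndo, sum_apply]

namespace IsCuntzFamily

theorem norm_cuntzEndo_le (hS : IsCuntzFamily S) (X : H →L[ℂ] H) : ‖cuntzEndo S X‖ ≤ ‖X‖ := by
  refine opNorm_le_bound _ (norm_nonneg _) fun x => ?_
  refine le_of_sq_le_sq ?_ (by positivity)
  rw [cuntzEndo_apply, hS.norm_sum_sq, mul_pow, ← hS.sum_norm_adjoint_sq, Finset.mul_sum]
  refine Finset.sum_le_sum fun i _ => ?_
  rw [← mul_pow]
  gcongr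
  exact X.le_opNorm _

theorem norm_iterate_cuntzEndo_le (hS : IsCuntzFamily S) (X : H →L[ℂ] H) (n : ℕ) :
    ‖(cuntzEndo S)^[n] X‖ ≤ ‖X‖ := by
  induction n with
  | zero => simp
  | succ n ih =>
    rw [Function.iterate_succ_apply']
    exact (hS.norm_cuntzEndo_le _).trans ih

theorem iterate_cuntzEndo_one (hS : IsCuntzFamily S) (n : ℕ) : (cuntzEndo S)^[n] 1 = 1 :=
  Function.iterate_fixed (by simpa [cuntzEndo] using hS.sum_mul_adjoint) n

theorem inner_cuntzEndo (hS : IsCuntzFamily S) (X : H →L[ℂ] H) (i j : Fin N) (x y : H) :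
    inner ℂ (cuntzEndo S X (S i x)) (S j y) = if i = j then inner ℂ (X x) y else 0 := by
  rw [← adjoint_inner_left, cuntzEndo_apply, map_sum]
  simp only [hS.adjoint_apply_apply, Finset.sum_ite_eq, Finset.mem_univ, if_true]
  rcases eq_or_ne i j with rfl | h
  · simp
  · simp [h, h.symm]

/-- Each letter common to both sides cancels one iterate. -/
theorem inner_iterate_cuntzEndo_wordOp (hS : IsCuntzFamily S) (X : H →L[ℂ] H)
    (ω : List (Fin N)) (n : ℕ) (x y : H) :
    inner ℂ ((cuntzEndo S)^[ω.length + n] X (wordOp S ω x)) (wordOp S ω y) =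
      inner ℂ ((cuntzEndo S)^[n] X x) y := by
  induction ω with
  | nil => simp
  | cons i ω ih =>
    have : (i :: ω).length + n = (ω.length + n) + 1 := by simp; omega
    rw [this, Function.iterate_succ_apply', wordOp_cons]
    simp [hS.inner_cuntzEndo, ih]

/-- Incomparable words differ at some first position. Peeling the common letters costs one iterate
each, and at the differing letter one more iterate meets orthogonal ranges; `a.length` iterates
suffice. -/
theorem inner_iterate_cuntzEndo_eq_zero (hS : IsCuntzFamily S) (X : H →L[ℂ] H)
    (a : List (Fin N)) : ∀ (b : List (Fin N)), ¬ a <+: b → ¬ b <+: a →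
    ∀ (n : ℕ), a.length ≤ n → ∀ x y : H,
    inner ℂ ((cuntzEndo S)^[n] X (wordOp S a x)) (wordOp S b y) = 0 := by
  induction a with
  | nil => intro b h; exact absurd List.nil_prefix h
  | cons i a ih =>
    intro b h h' n hn x y
    cases b with
    | nil => exact absurd List.nil_prefix h'
    | cons j b =>
      obtain ⟨n, rfl⟩ : ∃ m, n = m + 1 := ⟨n - 1, by simp at hn; omega⟩
      rw [Function.iterate_succ_apply', wordOp_cons, wordOp_cons]
      change inner ℂ (cuntzEndo S _ (S i _)) (S j _) = 0
      rw [hS.inner_cuntzEndo]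
      split_ifs with hij
      · subst hij
        simp only [List.cons_prefix_cons, true_and] at h h'
        exact ih b h h' n (by simpa using hn) x y
      · rfl

variable {β : List (Fin N)} {x : H}

theorem eventually_inner_iterate_cuntzEndo_eq_zero (hS : IsCuntzFamily S)
    (hβ : IsIrreducibleWord β) (hx : wordOp S β x = x) (X : H →L[ℂ] H) {γ δ : List (Fin N)}
    (hγ : γ ∈ wordsNotEndingIn β) (hδ : δ ∈ wordsNotEndingIn β) (hne : γ ≠ δ) :
    ∀ᶠ n in Filter.atTop,
      inner ℂ ((cuntzEndo S)^[n] X (wordOp S γ x)) (wordOp S δ x) = 0 := by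
  obtain ⟨k, m, h1, h2⟩ := hβ.exists_incomparable hγ hδ hne
  filter_upwards [Filter.eventually_ge_atTop (γ ++ (List.replicate k β).flatten).length]
    with n hn
  rw [← wordOp_append_power_apply hx γ k, ← wordOp_append_power_apply hx δ m]
  exact hS.inner_iterate_cuntzEndo_eq_zero X _ _ h1 h2 n hn x x

theorem orthonormal_wordOp (hS : IsCuntzFamily S) (hβ : IsIrreducibleWord β)
    (hx : wordOp S β x = x) (hx1 : ‖x‖ = 1) :
    Orthonormal ℂ (fun ω : wordsNotEndingIn β => wordOp S ω.1 x) := by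
  refine ⟨fun ω => by rw [hS.norm_wordOp, hx1], fun γ δ hne => ?_⟩
  -- For `X = 1`, fixed by the endomorphism, the vanishing coefficient is the plain inner product.
  obtain ⟨n, hn⟩ := (hS.eventually_inner_iterate_cuntzEndo_eq_zero hβ hx 1 γ.2 δ.2
    (fun h => hne (Subtype.ext h))).exists
  simpa [hS.iterate_cuntzEndo_one] using hn

theorem adjoint_apply_mem_wordSpan (hS : IsCuntzFamily S) (hβ : β ≠ [])
    (hx : wordOp S β x = x) (i : Fin N) :
    ∀ y ∈ (Submodule.span ℂ
      (Set.range fun ω : List (Fin N) => wordOp S ω x)).topologicalClosure,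
      adjoint (S i) y ∈ (Submodule.span ℂ
        (Set.range fun ω : List (Fin N) => wordOp S ω x)).topologicalClosure := by
  refine mem_topologicalClosure_span_of_forall (Submodule.isClosed_topologicalClosure _) _ ?_
  have hcons : ∀ (j : Fin N) (ω : List (Fin N)), adjoint (S i) (wordOp S (j :: ω) x) ∈
      (Submodule.span ℂ
        (Set.range fun ω : List (Fin N) => wordOp S ω x)).topologicalClosure := by
    intro j ω
    rw [wordOp_cons, mul_apply_eq_comp, hS.adjoint_apply_apply]
    split_ifs
    · exact Submodule.le_topologicalClosure _ (Submodule.subset_span ⟨ω, rfl⟩)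
    · exact Submodule.zero_mem _
  rintro _ ⟨ω, rfl⟩
  match ω, β, hβ with
  | j :: ω, _, _ => exact hcons j ω
  -- The empty word has no letter to remove, but `x = S_β x` supplies one.
  | [], j :: β', _ =>
    have := hcons j β'
    rw [hx] at this
    simpa using this

/-- If the commutant is trivial, then there are no proper reducing subspaces. -/
theorem eq_bot_or_eq_top_of_centralizer (h : Set.centralizer (Set.range S) = scalarOps H)
    (W : Submodule ℂ H) (hW : IsClosed (W : Set H)) (h1 : ∀ i, ∀ x ∈ W, S i x ∈ W)
    (h2 : ∀ i, ∀ x ∈ W, adjoint (S i) x ∈ W) : W = ⊥ ∨ W = ⊤ := by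
  have : CompleteSpace W := hW.completeSpace_coe
  have hP : W.starProjection ∈ Set.centralizer (Set.range S) := by
    rintro _ ⟨i, rfl⟩
    ext x
    refine (Submodule.eq_starProjection_of_mem_orthogonal
      (h1 i _ (Submodule.starProjection_apply_mem W x)) ?_).symm
    change S i x - S i (W.starProjection x) ∈ Wᗮ
    rw [← map_sub, Submodule.mem_orthogonal]
    intro u hu
    rw [← adjoint_inner_left]
    exact (Submodule.mem_orthogonal _ _).mp (Submodule.sub_starProjection_mem_orthogonal x) _
      (h2 i u hu)
  rw [h] at hP
  obtain ⟨c, hc⟩ := hP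
  have hc' : ∀ x, c • x = W.starProjection x := fun x =>
    congrArg (fun T : H →L[ℂ] H => T x) hc
  rcases eq_or_ne c 0 with rfl | hc0
  · left
    rw [Submodule.eq_bot_iff]
    intro x hx
    rw [← Submodule.starProjection_eq_self_iff.mpr hx, ← hc', zero_smul]
  · right
    rw [Submodule.eq_top_iff']
    intro x
    have := W.smul_mem c⁻¹ (Submodule.starProjection_apply_mem W x)
    rwa [← hc', inv_smul_smul₀ hc0] at this

end IsCuntzFamily

end Cuntz

/-! ### The dilation: passing between `K` and `H` -/

section Dilation

variable {N : ℕ} {K H : Type*}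
  [NormedAddCommGroup K] [InnerProductSpace ℂ K] [CompleteSpace K]
  [NormedAddCommGroup H] [InnerProductSpace ℂ H] [CompleteSpace H]
  {V : Fin N → K →L[ℂ] K} {S : Fin N → H →L[ℂ] H} {ι : K →ₗᵢ[ℂ] H}

namespace IsCuntzDilation

theorem adjoint_wordOp_apply (hS : IsCuntzDilation V S ι) (ω : List (Fin N)) (k : K) :
    adjoint (wordOp S ω) (ι k) = ι (adjoint (wordOp V ω) k) := by
  induction ω generalizing k with
  | nil => simp [← star_eq_adjoint]
  | cons i ω ih =>
    rw [wordOp_cons, wordOp_cons, ← star_eq_adjoint, ← star_eq_adjoint, star_mul, star_mul]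
    change adjoint (wordOp S ω) (adjoint (S i) (ι k)) =
      ι (adjoint (wordOp V ω) (adjoint (V i) k))
    rw [hS.adjoint_apply, ih]

theorem inner_wordOp (hS : IsCuntzDilation V S ι) (ω : List (Fin N)) (v k : K) :
    inner ℂ (ι v) (wordOp S ω (ι k)) = inner ℂ v (wordOp V ω k) := by
  rw [← adjoint_inner_left, hS.adjoint_wordOp_apply, ι.inner_map_map, adjoint_inner_left]

/-- A closed reducing subspace that contains `K` is everything. -/
theorem eq_top_of_reducing (hS : IsCuntzDilation V S ι) (W : Submodule ℂ H)
    (hW : IsClosed (W : Set H)) (h1 : ∀ i, ∀ x ∈ W, S i x ∈ W)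
    (h2 : ∀ i, ∀ x ∈ W, adjoint (S i) x ∈ W) (hK : ∀ k, ι k ∈ W) : W = ⊤ := by
  have hA : ∀ A ∈ StarAlgebra.adjoin ℂ (Set.range S), ∀ x ∈ W, A x ∈ W := by
    intro A hA
    rw [← StarSubalgebra.mem_toSubalgebra, StarAlgebra.adjoin_toSubalgebra] at hA
    induction hA using Algebra.adjoin_induction with
    | mem A hA =>
      rcases hA with ⟨i, rfl⟩ | ⟨i, hi⟩
      · exact h1 i
      · have : A = adjoint (S i) := by rw [← star_eq_adjoint, hi, star_star]
        exact this ▸ h2 i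
    | algebraMap c =>
      intro x hx
      simpa [Algebra.algebraMap_eq_smul_one] using W.smul_mem c hx
    | add A B _ _ hA hB => exact fun x hx => W.add_mem (hA x hx) (hB x hx)
    | mul A B _ _ hA hB => exact fun x hx => hA _ (hB x hx)
  rw [eq_top_iff, ← hS.cyclic]
  refine Submodule.topologicalClosure_minimal _ (Submodule.span_le.mpr ?_) hW
  rintro _ ⟨A, hAm, k, rfl⟩
  exact hA A hAm _ (hK k)

/-- Adjoints are not needed to generate `H` from `K`: `S_i^*` deletes a leading letter or gives
zero, and preserves `K`. -/
theorem span_wordOp_eq_top (hS : IsCuntzDilation V S ι) :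
    (Submodule.span ℂ {x : H | ∃ ω k, x = wordOp S ω (ι k)}).topologicalClosure = ⊤ := by
  have hmem : ∀ ω k, wordOp S ω (ι k) ∈
      (Submodule.span ℂ {x : H | ∃ ω k, x = wordOp S ω (ι k)}).topologicalClosure :=
    fun ω k => Submodule.le_topologicalClosure _ (Submodule.subset_span ⟨ω, k, rfl⟩)
  refine hS.eq_top_of_reducing _ (Submodule.isClosed_topologicalClosure _) (fun i => ?_)
    (fun i => ?_) (fun k => by simpa using hmem [] k)
  · refine mem_topologicalClosure_span_of_forall (Submodule.isClosed_topologicalClosure _) _ ?_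
    rintro _ ⟨ω, k, rfl⟩
    simpa [wordOp_cons] using hmem (i :: ω) k
  · refine mem_topologicalClosure_span_of_forall (Submodule.isClosed_topologicalClosure _) _ ?_
    rintro _ ⟨ω, k, rfl⟩
    cases ω with
    | nil => simpa [hS.adjoint_apply] using hmem [] (adjoint (V i) k)
    | cons j ω =>
      rw [wordOp_cons, mul_apply_eq_comp, hS.cuntz.adjoint_apply_apply]
      split_ifs
      · exact hmem ω k
      · exact Submodule.zero_mem _

/-- An operator commuting with the `S_i` whose compression to `K` vanishes is zero. -/
theorem eq_zero_of_compression_eq_zero (hS : IsCuntzDilation V S ι) {B : H →L[ℂ] H}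
    (hB : ∀ i x, B (S i x) = S i (B x)) (h : ∀ k k', inner ℂ (B (ι k)) (ι k') = 0) :
    B = 0 := by
  have hword : ∀ ω x, B (wordOp S ω x) = wordOp S ω (B x) := by
    intro ω
    induction ω with
    | nil => simp
    | cons i ω ih => intro x; simp [wordOp_cons, hB, ih]
  have horth : ∀ ω k k', inner ℂ (B (ι k)) (wordOp S ω (ι k')) = 0 := by
    intro ω
    induction ω with
    | nil => simpa using h
    | cons i ω ih =>
      intro k k'
      -- `S_i^* B k = B S_i^* k = B V_i^* k`, so the first vector stays of the form `B ι(·)` and the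
      -- word gets shorter.
      rw [wordOp_cons, mul_apply_eq_comp, ← adjoint_inner_left, hS.cuntz.mul_adjoint_eq_of_comm hB,
        hS.adjoint_apply, ih]
  have hK : ∀ k, B (ι k) = 0 := by
    intro k
    have : innerSL ℂ (B (ι k)) = 0 := by
      refine clm_eq_zero_of_forall hS.span_wordOp_eq_top _ ?_
      rintro _ ⟨ω, k', rfl⟩
      simpa using horth ω k k'
    simpa using congrArg (fun f : H →L[ℂ] ℂ => f (B (ι k))) this
  refine clm_eq_zero_of_forall hS.span_wordOp_eq_top _ ?_
  rintro _ ⟨ω, k, rfl⟩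
  rw [hword, hK, map_zero]

/-- This is the adjoint of `S_i^* ι = ι V_i^*`. -/
theorem apply_adjoint_embedding (hS : IsCuntzDilation V S ι) (i : Fin N) (x : H) :
    V i (adjoint ι.toContinuousLinearMap x) = adjoint ι.toContinuousLinearMap (S i x) := by
  refine ext_inner_left ℂ fun k => ?_
  rw [← adjoint_inner_left, adjoint_inner_right, adjoint_inner_right, ← adjoint_inner_left (S i)]
  simp [hS.adjoint_apply]

theorem centralizer_eq_of_sigmaFixedPoints (hS : IsCuntzDilation V S ι)
    (h : sigmaFixedPoints V = scalarOps K) :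
    Set.centralizer (Set.range S) = scalarOps H := by
  apply Set.Subset.antisymm
  · intro A hA
    have hcomm : ∀ i x, A (S i x) = S i (A x) := fun i x =>
      (congrArg (fun T : H →L[ℂ] H => T x) (hA (S i) ⟨i, rfl⟩)).symm
    -- `∑ V_i ι^* A ι V_i^* = ι^* (∑ S_i A S_i^*) ι = ι^* A ι`, as `A` commutes with the `S_i`.
    have hC : adjoint ι.toContinuousLinearMap ∘L A ∘L ι.toContinuousLinearMap ∈
        sigmaFixedPoints V := by
      ext k
      rw [sum_apply]
      change ∑ i, V i (adjoint ι.toContinuousLinearMap (A (ι (adjoint (V i) k)))) =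
        adjoint ι.toContinuousLinearMap (A (ι k))
      simp only [hS.apply_adjoint_embedding, ← hS.adjoint_apply, ← hcomm, ← map_sum,
        hS.cuntz.sum_apply_adjoint_apply]
    rw [h] at hC
    obtain ⟨c, hc⟩ := hC
    refine ⟨c, ?_⟩
    have hzero : A - c • 1 = 0 := by
      refine hS.eq_zero_of_compression_eq_zero (fun i x => by simp [hcomm]) fun k k' => ?_
      have hck : inner ℂ (c • k) k' =
          inner ℂ (adjoint ι.toContinuousLinearMap (A (ι k))) k' :=
        congrArg (fun T : K →L[ℂ] K => inner ℂ (T k) k') hc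
      rw [adjoint_inner_left, inner_smul_left] at hck
      change inner ℂ (A (ι k) - c • ι k) (ι k') = 0
      rw [inner_sub_left, inner_smul_left, ι.inner_map_map, hck, sub_eq_zero]
      rfl
    exact (sub_eq_zero.mp hzero).symm
  · rintro _ ⟨c, rfl⟩ _ ⟨i, rfl⟩
    simp

/-- Because `S_i^*` acts on `K` as `V_i^*`, the endomorphism of `B(H)` compresses to `σ`, which
fixes `B`. -/
theorem inner_iterate_cuntzEndo_compression (hS : IsCuntzDilation V S ι) {B : K →L[ℂ] K}
    (hB : B ∈ sigmaFixedPoints V) (n : ℕ) (k k' : K) :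
    inner ℂ ((cuntzEndo S)^[n]
      (ι.toContinuousLinearMap ∘L B ∘L adjoint ι.toContinuousLinearMap) (ι k)) (ι k') =
      inner ℂ (B k) k' := by
  induction n generalizing k k' with
  | zero =>
    have hι : adjoint ι.toContinuousLinearMap (ι k) = k := by
      refine ext_inner_left ℂ fun u => ?_
      rw [adjoint_inner_right]
      simp
    simp [hι]
  | succ n ih =>
    rw [Function.iterate_succ_apply', cuntzEndo_apply, sum_inner]
    simp only [← adjoint_inner_right (S _), hS.adjoint_apply, ih]
    simp only [adjoint_inner_right, ← sum_inner]
    have := congrArg (fun T : K →L[ℂ] K => inner ℂ (T k) k') hB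
    simpa [sum_apply, sum_inner] using this

theorem sigmaFixedPoints_eq_of_cyclic (hV : IsRowCoisometry V) (hS : IsCuntzDilation V S ι)
    {v₀ : K} (hv₀ : ‖v₀‖ = 1) {β : List (Fin N)} (hβ : IsIrreducibleWord β)
    (hfix : wordOp S β (ι v₀) = ι v₀)
    (h : (Submodule.span ℂ
      (Set.range fun ω : List (Fin N) => wordOp S ω (ι v₀))).topologicalClosure = ⊤) :
    sigmaFixedPoints V = scalarOps K := by
  have hscalar : ∀ c : ℂ, c • (1 : K →L[ℂ] K) ∈ sigmaFixedPoints V := by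
    intro c
    simp only [sigmaFixedPoints, Set.mem_ofPred_eq, mul_smul_comm, smul_mul_assoc, mul_one,
      ← Finset.smul_sum]
    rw [hV]
  apply Set.Subset.antisymm
  · intro A hA
    have hA' : ∑ i, V i * A * adjoint (V i) = A := hA
    -- The only scalar for which `A - c` has zero expectation at the unit vector `v₀`.
    set c : ℂ := inner ℂ v₀ (A v₀) with hc
    refine ⟨c, ?_⟩
    set B : K →L[ℂ] K := A - c • 1 with hBdef
    have hB : B ∈ sigmaFixedPoints V := by
      have hc' : ∑ i, V i * (c • (1 : K →L[ℂ] K)) * adjoint (V i) = c • 1 := hscalar c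
      change ∑ i, V i * B * adjoint (V i) = B
      simp only [hBdef, mul_sub, sub_mul, Finset.sum_sub_distrib, hA', hc']
    have hB0 : inner ℂ (B v₀) v₀ = 0 := by
      rw [← inner_conj_symm, map_eq_zero, hBdef]
      simp [inner_sub_right, inner_smul_right, ← hc, inner_self_eq_norm_sq_to_K, hv₀]
    rw [← range_wordOp_eq hβ.1 hfix] at h
    have hlim := tendsto_inner_zero_of_total h
      (fun n => (cuntzEndo S)^[n]
        (ι.toContinuousLinearMap ∘L B ∘L adjoint ι.toContinuousLinearMap))
      _ (hS.cuntz.norm_iterate_cuntzEndo_le _) (by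
        rintro _ ⟨γ, rfl⟩ _ ⟨δ, rfl⟩
        apply tendsto_const_nhds.congr'
        -- Diagonal coefficients eventually equal `⟨B v₀, v₀⟩ = 0`; off-diagonal ones eventually
        -- vanish by incomparability.
        rcases eq_or_ne γ δ with rfl | hne
        · filter_upwards [Filter.eventually_ge_atTop γ.1.length] with n hn
          obtain ⟨m, rfl⟩ := Nat.exists_eq_add_of_le hn
          rw [hS.cuntz.inner_iterate_cuntzEndo_wordOp, hS.inner_iterate_cuntzEndo_compression hB,
            hB0]
        · filter_upwards [hS.cuntz.eventually_inner_iterate_cuntzEndo_eq_zero hβ hfix _ γ.2 δ.2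
            (fun h => hne (Subtype.ext h))] with n hn
          exact hn.symm)
    have hzero : B = 0 := by
      ext k
      refine ext_inner_right ℂ fun k' => ?_
      have h1 := hlim (ι k) (ι k')
      simp only [hS.inner_iterate_cuntzEndo_compression hB] at h1
      simpa using tendsto_nhds_unique tendsto_const_nhds h1
    exact (sub_eq_zero.mp hzero).symm
  · rintro _ ⟨c, rfl⟩
    exact hscalar c

theorem cyclic_of_isParsevalFrame (hS : IsCuntzDilation V S ι)
    {v₀ : K} (hv₀ : ‖v₀‖ = 1) {β : List (Fin N)} (hβ : IsIrreducibleWord β)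
    (hfix : wordOp S β (ι v₀) = ι v₀)
    (h : IsParsevalFrame (fun ω : wordsNotEndingIn β => wordOp V ω.1 v₀)) :
    (Submodule.span ℂ
      (Set.range fun ω : List (Fin N) => wordOp S ω (ι v₀))).topologicalClosure = ⊤ := by
  have hclosed : IsClosed ((Submodule.span ℂ (Set.range fun ω : List (Fin N) =>
    wordOp S ω (ι v₀))).topologicalClosure : Set H) := Submodule.isClosed_topologicalClosure _
  refine hS.eq_top_of_reducing _ hclosed (apply_mem_wordSpan _)
    (hS.cuntz.adjoint_apply_mem_wordSpan hβ.1 hfix) fun v => ?_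
  set W := (Submodule.span ℂ
    (Set.range fun ω : List (Fin N) => wordOp S ω (ι v₀))).topologicalClosure
  have : CompleteSpace W := hclosed.completeSpace_coe
  have hon := hS.cuntz.orthonormal_wordOp hβ hfix (by simpa using hv₀)
  have hinner : ∀ ω : List (Fin N), inner ℂ (wordOp S ω (ι v₀)) (W.starProjection (ι v)) =
      inner ℂ (wordOp S ω (ι v₀)) (ι v) := by
    intro ω
    have hω : wordOp S ω (ι v₀) ∈ W :=
      Submodule.le_topologicalClosure _ (Submodule.subset_span ⟨ω, rfl⟩)
    rw [← Submodule.inner_starProjection_left_eq_right,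
      Submodule.starProjection_eq_self_iff.mpr hω]
  -- Bessel for the projection of `ι v`: its coefficients are those of `ι v`, whose squares sum to
  -- `‖v‖²` by the Parseval hypothesis.
  have hle : ‖ι v‖ ^ 2 ≤ ‖W.starProjection (ι v)‖ ^ 2 := by
    have hB := hon.tsum_inner_products_le (W.starProjection (ι v))
    simp only [hinner] at hB
    refine le_trans (le_of_eq ?_) hB
    rw [ι.norm_map, ← (h v).tsum_eq]
    refine tsum_congr fun ω => ?_
    rw [norm_inner_symm (wordOp S ω.1 (ι v₀)), hS.inner_wordOp]
  have hz : ‖ι v - W.starProjection (ι v)‖ ^ 2 = 0 := by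
    have h1 := Submodule.norm_sq_eq_add_norm_sq_starProjection (ι v) W
    rw [Submodule.starProjection_orthogonal_val] at h1
    nlinarith [sq_nonneg ‖ι v - W.starProjection (ι v)‖]
  have : ι v = W.starProjection (ι v) :=
    sub_eq_zero.mp (norm_eq_zero.mp (pow_eq_zero_iff two_ne_zero |>.mp hz))
  rw [this]
  exact Submodule.starProjection_apply_mem W _

/-- The frame is the orthogonal projection of the basis onto `K`, so the coefficients of vectors of
`K` agree. -/
theorem isParsevalFrame_of_isONB (hS : IsCuntzDilation V S ι) {v₀ : K} {J : Set (List (Fin N))}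
    (h : IsONB (fun ω : J => wordOp S ω.1 (ι v₀))) :
    IsParsevalFrame (fun ω : J => wordOp V ω.1 v₀) := by
  obtain ⟨b, hb⟩ := h
  intro v
  have h1 := (b.hasSum_inner_mul_inner (ι v) (ι v)).mapL Complex.reCLM
  have h2 : ∀ ω : J, b ω = wordOp S ω.1 (ι v₀) := fun ω => congrFun hb ω
  convert h1 using 1
  · ext ω
    rw [← hS.inner_wordOp, ← h2, ← inner_conj_symm (b ω), Complex.reCLM_apply,
      Complex.mul_conj, Complex.ofReal_re, Complex.normSq_eq_norm_sq]
  · rw [Complex.reCLM_apply, inner_self_eq_norm_sq_to_K, ι.norm_map]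
    norm_cast

end IsCuntzDilation

end Dilation

/-! ### The equivalences -/

theorem theorem3p9 {N : ℕ} (hN : 2 ≤ N) {K H : Type*}
    [NormedAddCommGroup K] [InnerProductSpace ℂ K] [CompleteSpace K]
    [NormedAddCommGroup H] [InnerProductSpace ℂ H] [CompleteSpace H]
    (V : Fin N → K →L[ℂ] K) (hV : IsRowCoisometry V)
    (S : Fin N → H →L[ℂ] H) (ι : K →ₗᵢ[ℂ] H) (hS : IsCuntzDilation V S ι)
    (v₀ : K) (hv₀ : ‖v₀‖ = 1)
    (β : List (Fin N)) (hβ : IsIrreducibleWord β)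
    (hfix : ContinuousLinearMap.adjoint (wordOp V β) v₀ = v₀) :
    List.TFAE [
      IsParsevalFrame (fun ω : wordsNotEndingIn β => wordOp V ω.1 v₀),
      IsONB (fun ω : wordsNotEndingIn β => wordOp S ω.1 (ι v₀)),
      (Submodule.span ℂ
        (Set.range fun ω : List (Fin N) => wordOp S ω (ι v₀))).topologicalClosure = ⊤,
      IsIrreducibleRep S,
      Set.centralizer (Set.range S) = scalarOps H,
      sigmaFixedPoints V = scalarOps K] := by
  have hfixS : wordOp S β (ι v₀) = ι v₀ :=
    hS.cuntz.wordOp_apply_of_adjoint_apply (by rw [hS.adjoint_wordOp_apply, hfix])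
  have hnorm : ‖ι v₀‖ = 1 := by rw [ι.norm_map, hv₀]
  have hne : ι v₀ ≠ 0 := norm_ne_zero_iff.mp (by rw [hnorm]; exact one_ne_zero)
  tfae_have 1 → 3 := hS.cyclic_of_isParsevalFrame hv₀ hβ hfixS
  tfae_have 3 → 2 := fun h => by
    rw [← range_wordOp_eq hβ.1 hfixS] at h
    exact ⟨HilbertBasis.mk (hS.cuntz.orthonormal_wordOp hβ hfixS hnorm) h.ge,
      HilbertBasis.coe_mk _ _⟩
  tfae_have 2 → 1 := hS.isParsevalFrame_of_isONB
  tfae_have 3 → 6 := hS.sigmaFixedPoints_eq_of_cyclic hV hv₀ hβ hfixS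
  tfae_have 6 → 5 := hS.centralizer_eq_of_sigmaFixedPoints
  tfae_have 5 → 4 := fun h =>
    ⟨⟨ι v₀, 0, hne⟩, IsCuntzFamily.eq_bot_or_eq_top_of_centralizer h⟩
  -- The closed span is reducing and contains `ι v₀ ≠ 0`.
  tfae_have 4 → 3 := fun h => by
    refine (h.2 _ (Submodule.isClosed_topologicalClosure _)
      (apply_mem_wordSpan (ι v₀))
      (hS.cuntz.adjoint_apply_mem_wordSpan hβ.1 hfixS)).resolve_left fun hbot => hne ?_
    rw [← Submodule.mem_bot ℂ, ← hbot]
    exact Submodule.le_topologicalClosure _ (Submodule.subset_span ⟨[], by simp⟩)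
  tfae_finish
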